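/- Let $\mathcal S=\{1,2,\ldots\}$. For $x\in(0,1)$ let $q_{i,i+1}(x)=x$ for $i\ge 1$, $q_{i,i-1}(x)=1$ for $i\ge 2$, $q_{ii}(x)=-\sum_{j\ne i}q_{ij}(x)$, and $q_{ij}(x)=0$ otherwise (the birth–death rates on $\mathcal S$ with birth rate $x$ and death rate $1$). Each $q_{ij}$ is Lipschitz continuous in $x\in(0,1)$. For each $x$ there is exactly one transition semigroup $(P^x_t)_{t\ge 0}$ of Markov kernels on $\mathcal S$ with $P^x_0=I$, $P^x_{s+t}=P^x_sP^x_t$ and $\lim_{t\downarrow 0}\bigl(P^x_t(i,\{j\})-\delta_{ij}\bigr)/t=q_{ij}(x)$ for all $i,j$. For probability measures write $\|\mu-\nu\|_{\mathrm{var}}=2\sup_{A\subseteq\mathcal S}(\mu(A)-\nu(A))$. (i) For each $x\in(0,1)$, $P^x$ has exactly one invariant probability measure $\pi^x$. The chain is exponentially ergodic, i.e. there are $\varepsilon>0$ and constants $C_i>0$ with $\|P^x_t(i,\cdot)-\pi^x\|_{\mathrm{var}}\le C_ie^{-\varepsilon t}$ for all $t>0$, $i\in\mathcal S$; more precisely there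 are constants $C_i(x)>0$ such that $$\|P^x_t(i,\cdot)-\pi^x\|_{\mathrm{var}}\le C_i(x)\,e^{-(1-\sqrt x)^2t},\qquad t>0,\ i\in\mathcal S.$$ The chain is not strongly ergodic, i.e. $\sup_{i\in\mathcal S}\|P^x_t(i,\cdot)-\pi^x\|_{\mathrm{var}}$ does not tend to $0$ as $t\to\infty$. (ii) $\pi^x_i=(1-x)x^{i-1}$ for $i\ge 1$, and for every $\beta\in(0,1]$ $$\sup_{x,y\in(0,1),\,x\ne y}\frac{\|\pi^x-\pi^y\|_{\mathrm{var}}}{|x-y|^\beta}=\infty,$$ so $x\mapsto\pi^x$ is not Hölder continuous on $(0,1)$ with any exponent $\beta\in(0,1]$: there is no constant $C$ with $\|\pi^x-\pi^y\|_{\mathrm{var}}\le C|x-y|^\beta$ for all $x,y\in(0,1)$. -/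

import Mathlib

open Set Filter Topology MeasureTheory ProbabilityTheory
open scoped NNReal ENNReal

noncomputable section

/-- The discrete sigma-algebra on the state space `{1, 2, …}`. -/
instance stateMeasurableSpace : MeasurableSpace ℕ+ := ⊤

instance stateDiscreteMeasurableSpace : DiscreteMeasurableSpace ℕ+ := ⟨fun _ => trivial⟩

/-- The rate matrix of the birth-death chain on `{1, 2, …}` with birth rates `b i` (`i ≥ 1`)
and death rates `a i` (`i ≥ 2`; the value `a 1` is not used). -/
def birthDeathRate (b a : ℕ+ → ℝ) (i j : ℕ+) : ℝ :=
  if j = i + 1 then b i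
  else if i = j + 1 then a i
  else if j = i then -(b i + if i = 1 then 0 else a i)
  else 0

/-- The rate matrix with birth rate `x` and death rate `1`. -/
def exampleRate (x : ℝ) : ℕ+ → ℕ+ → ℝ :=
  birthDeathRate (fun _ => x) (fun _ => 1)

/-- `P` is the (honest, standard) transition semigroup of a continuous-time Markov chain on the
countable space `S` with rate matrix `Q`: Markov kernels, identity at time zero,
Chapman-Kolmogorov, and `Q` is the matrix of right derivatives of the transition probabilities
at time zero. -/
structure IsTransitionSemigroup {S : Type*} [MeasurableSpace S] [DecidableEq S]
    (Q : S → S → ℝ) (P : ℝ≥0 → Kernel S S) : Prop where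
  markov : ∀ t, IsMarkovKernel (P t)
  zero : P 0 = Kernel.id
  add : ∀ s t, P (s + t) = P t ∘ₖ P s
  rate : ∀ i j, Tendsto
    (fun t : ℝ≥0 => ((P t i).real {j} - (if i = j then 1 else 0)) / (t : ℝ))
    (𝓝[>] 0) (𝓝 (Q i j))

/-- `μ` is an invariant probability measure of the semigroup `P`. -/
def IsInvariantLaw {S : Type*} [MeasurableSpace S]
    (P : ℝ≥0 → Kernel S S) (μ : Measure S) : Prop :=
  IsProbabilityMeasure μ ∧ ∀ t, (P t).Invariant μ

/-- The total variation norm `‖μ - ν‖_var = 2 sup_A (μ A - ν A)` of the difference of two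
probability measures (values in `[0, 2]`). -/
def tvNorm {S : Type*} [MeasurableSpace S] (μ ν : Measure S) : ℝ :=
  2 * ⨆ A : {A : Set S // MeasurableSet A}, (μ.real A - ν.real A)

/-- `‖P_t(i, ·) - μ‖_var ≤ C_i e^{-lam t}` for all `t > 0` and all `i`, with constants `C_i > 0`. -/
def ConvergesAtRate {S : Type*} [MeasurableSpace S]
    (P : ℝ≥0 → Kernel S S) (μ : Measure S) (lam : ℝ) : Prop :=
  ∃ C : S → ℝ, (∀ i, 0 < C i) ∧
    ∀ (t : ℝ≥0) (i : S), 0 < t → tvNorm (P t i) μ ≤ C i * Real.exp (-lam * t)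

/-- Exponential ergodicity. -/
def ExponentiallyErgodic {S : Type*} [MeasurableSpace S]
    (P : ℝ≥0 → Kernel S S) (μ : Measure S) : Prop :=
  ∃ ε : ℝ, 0 < ε ∧ ConvergesAtRate P μ ε

/-- Strong (uniform) ergodicity: `sup_i ‖P_t(i, ·) - μ‖_var → 0` as `t → ∞`. -/
def StronglyErgodic {S : Type*} [MeasurableSpace S]
    (P : ℝ≥0 → Kernel S S) (μ : Measure S) : Prop :=
  Tendsto (fun t : ℝ≥0 => ⨆ i, tvNorm (P t i) μ) atTop (𝓝 0)

end

/-! On bounded functions the generator is `Q = R - (1 + x)` with `R f i = x f(i+1) + f(i-1)`. Since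
`PNat` subtraction truncates (`1 - 1 = 1`), this formula also covers the boundary state. `R` is
bounded, so `exp (tQ)` is a Poisson-weighted series in the iterates of `R`. Reading it as a mixture
of measures gives existence. Any transition semigroup with these rates equals it
(`integral_eq_birthDeathSemigroup`), because `P_s exp((t-s)Q) f` is constant in `s`.

By `abs_apply_expSemigroup_le`, a bound `a ^ n` on iterates of `R` becomes the rate `a - (1 + x)` in
time. With `r = √x`, increments of `R^n 1_A` at `i` are at most `(2r)^n r⁻ⁱ`, and `2r - (1 + r²) =
-(1 - r)²`. Summing increments and averaging over the geometric law, under which `r⁻ⁱ` is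
integrable, gives convergence at the stated rate, hence uniqueness of the invariant law.

Strong ergodicity fails because, for fixed `t`, state 1 is almost unreachable from far away, while
it has mass `1 - x` in the limit. Hölder continuity fails near `x = 1`, where the tails `x ^ m`
separate parameters that are arbitrarily close. -/

open scoped BoundedContinuousFunction

/-! ### The semigroup of a bounded operator and its Poisson series -/

section ExpSemigroup

variable {E : Type*} [NormedAddCommGroup E] [NormedSpace ℝ E]

/-- The operator semigroup `exp (t (R - c))` generated by `R - c`. -/
noncomputable def expSemigroup (c : ℝ) (R : E →L[ℝ] E) (t : ℝ) : E →L[ℝ] E :=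
  Real.exp (-c * t) • NormedSpace.exp (t • R)

theorem expSemigroup_zero (c : ℝ) (R : E →L[ℝ] E) (f : E) : expSemigroup c R 0 f = f := by
  simp [expSemigroup]

/-- The majorant for Poisson series; with `a = c` it also gives total mass one and invariance. -/
theorem hasSum_exp_mul_pow_div_factorial (c t a C : ℝ) :
    HasSum (fun n : ℕ => Real.exp (-c * t) * (t ^ n / n.factorial) * (a ^ n * C))
      (Real.exp ((a - c) * t) * C) := by
  have h := ((NormedSpace.expSeries_div_hasSum_exp (t * a)).mul_left (Real.exp (-c * t))).mul_right C
  rw [← Real.exp_eq_exp_ℝ, ← Real.exp_add] at h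
  have h1 : (a - c) * t = -c * t + t * a := by ring
  rw [h1]
  convert! h using 2 with n
  rw [mul_pow]; ring

variable [CompleteSpace E]

theorem expSemigroup_add (c : ℝ) (R : E →L[ℝ] E) (s t : ℝ) (f : E) :
    expSemigroup c R (s + t) f = expSemigroup c R s (expSemigroup c R t f) := by
  let _ : NormedAlgebra ℚ (E →L[ℝ] E) := NormedAlgebra.restrictScalars ℚ ℝ _
  have hc : Commute (s • R) (t • R) := ((Commute.refl _).smul_left s).smul_right t
  rw [expSemigroup, expSemigroup, expSemigroup, add_smul,
    NormedSpace.exp_add_of_commute hc, mul_add, Real.exp_add]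
  simp [smul_smul, mul_comm (Real.exp (-(c * s)))]

theorem hasDerivAt_expSemigroup (c : ℝ) (R : E →L[ℝ] E) (t : ℝ) (f : E) :
    HasDerivAt (fun t => expSemigroup c R t f)
      (R (expSemigroup c R t f) - c • expSemigroup c R t f) t := by
  have h1 := hasDerivAt_exp_smul_const' (𝕂 := ℝ) R t
  have h2 : HasDerivAt (fun t : ℝ => Real.exp (-c * t)) (Real.exp (-c * t) * (-c)) t := by
    simpa using ((hasDerivAt_id t).const_mul (-c)).exp
  have h3 := h2.smul (h1.clm_apply (hasDerivAt_const t f))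
  convert! h3 using 1
  simp only [expSemigroup, FunLike.coe_smul, Pi.smul_apply, map_smul,
    mul_apply_eq_comp, map_zero, add_zero, smul_smul, mul_neg, neg_smul,
    sub_eq_add_neg, mul_comm c]

theorem hasSum_expSemigroup (c : ℝ) (R : E →L[ℝ] E) (t : ℝ) (φ : E →L[ℝ] ℝ) (f : E) :
    HasSum (fun n : ℕ => Real.exp (-c * t) * (t ^ n / n.factorial) * φ (R^[n] f))
      (φ (expSemigroup c R t f)) := by
  have h := NormedSpace.exp_series_hasSum_exp' (𝕂 := ℝ) (t • R)
  have h2 := (h.mapL (ContinuousLinearMap.apply ℝ E f)).mapL φ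
  have h3 := h2.mul_left (Real.exp (-c * t))
  convert! h3 using 1
  · ext n
    rw [smul_pow, map_smul, map_smul, map_smul, map_smul, ContinuousLinearMap.apply_apply,
      FunLike.coe_pow_eq_iterate]
    simp only [smul_eq_mul]
    ring
  · simp [expSemigroup]

theorem abs_apply_expSemigroup_le {c : ℝ} {R : E →L[ℝ] E} {t : ℝ} (ht : 0 ≤ t) {φ : E →L[ℝ] ℝ}
    {f : E} {a C : ℝ} (h : ∀ n : ℕ, |φ (R^[n] f)| ≤ a ^ n * C) :
    |φ (expSemigroup c R t f)| ≤ Real.exp ((a - c) * t) * C := by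
  refine (hasSum_expSemigroup c R t φ f).norm_le_of_bounded
    (hasSum_exp_mul_pow_div_factorial c t a C) fun n => ?_
  rw [norm_mul, Real.norm_of_nonneg (by positivity)]
  gcongr
  exact h n

/-- A left eigenvector of `R` with eigenvalue `c` is annihilated by `R - c`; this is how invariance
of the geometric law enters. -/
theorem apply_expSemigroup_eq {c : ℝ} {R : E →L[ℝ] E} (t : ℝ) {φ : E →L[ℝ] ℝ}
    (h : ∀ f, φ (R f) = c * φ f) (f : E) : φ (expSemigroup c R t f) = φ f := by
  have hn : ∀ n : ℕ, φ (R^[n] f) = c ^ n * φ f := by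
    intro n
    induction n with
    | zero => simp
    | succ n ih => rw [Function.iterate_succ_apply', h, ih]; ring
  have h1 := hasSum_expSemigroup c R t φ f
  simp only [hn] at h1
  simpa using h1.unique (hasSum_exp_mul_pow_div_factorial c t c (φ f))

end ExpSemigroup

/-! ### The generator on bounded functions -/

/-- The bounded operator `f ↦ x f(· + 1) + f(· - 1)` (with `1 - 1 = 1`), which is the generator of
the birth-death chain shifted by `1 + x`. -/
noncomputable def shiftedGenerator (x : ℝ) : (ℕ+ →ᵇ ℝ) →L[ℝ] (ℕ+ →ᵇ ℝ) :=
  LinearMap.mkContinuous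
    { toFun := fun f => x • f.compContinuous ⟨fun i => i + 1, continuous_of_discreteTopology⟩ +
        f.compContinuous ⟨fun i => i - 1, continuous_of_discreteTopology⟩
      map_add' := fun f g => by ext i; simp; ring
      map_smul' := fun a f => by ext i; simp; ring }
    (|x| + 1) fun f => by
      refine (BoundedContinuousFunction.norm_le (by positivity)).2 fun i => ?_
      have h1 := f.norm_coe_le_norm (i + 1)
      have h2 := f.norm_coe_le_norm (i - 1)
      simp only [LinearMap.coe_mk, AddHom.coe_mk, BoundedContinuousFunction.coe_add,
        BoundedContinuousFunction.coe_smul, Pi.add_apply, smul_eq_mul,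
        BoundedContinuousFunction.compContinuous_apply, ContinuousMap.coe_mk]
      refine (norm_add_le _ _).trans ?_
      rw [norm_mul, add_mul, one_mul, Real.norm_eq_abs x]
      gcongr

@[simp]
theorem shiftedGenerator_apply (x : ℝ) (f : ℕ+ →ᵇ ℝ) (i : ℕ+) :
    shiftedGenerator x f i = x * f (i + 1) + f (i - 1) := rfl

/-- The operator semigroup `exp (t Q)`, where `Q` is the generator of the birth-death chain. -/
noncomputable def birthDeathSemigroup (x t : ℝ) : (ℕ+ →ᵇ ℝ) →L[ℝ] (ℕ+ →ᵇ ℝ) :=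
  expSemigroup (1 + x) (shiftedGenerator x) t

/-- The generator of the birth-death chain, applied to a bounded function. -/
noncomputable def birthDeathGenerator (x : ℝ) (f : ℕ+ →ᵇ ℝ) : ℕ+ →ᵇ ℝ :=
  shiftedGenerator x f - (1 + x) • f

theorem birthDeathGenerator_apply (x : ℝ) (f : ℕ+ →ᵇ ℝ) (i : ℕ+) :
    birthDeathGenerator x f i = x * f (i + 1) + f (i - 1) - (1 + x) * f i := rfl

theorem hasDerivAt_birthDeathSemigroup (x t : ℝ) (f : ℕ+ →ᵇ ℝ) :
    HasDerivAt (fun t => birthDeathSemigroup x t f)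
      (birthDeathGenerator x (birthDeathSemigroup x t f)) t :=
  hasDerivAt_expSemigroup (1 + x) (shiftedGenerator x) t f

/-- At state 1 the truncated `i - 1` is a jump in place, which cancels the extra death rate in the
diagonal term `1 + x`. -/
theorem exampleRate_eq (x : ℝ) (i j : ℕ+) :
    exampleRate x i j = x * (if i + 1 = j then 1 else 0) + (if i - 1 = j then 1 else 0) -
      (1 + x) * (if i = j then 1 else 0) := by
  have h1 : i - 1 = j ↔ i = j + 1 ∨ (i = 1 ∧ j = 1) := by
    rw [← PNat.coe_inj, ← PNat.coe_inj, PNat.sub_coe, ← PNat.coe_inj, ← PNat.coe_inj,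
      PNat.add_coe]
    have := i.pos
    have := j.pos
    simp only [PNat.one_coe, ← PNat.coe_lt_coe]
    split_ifs <;> omega
  simp only [exampleRate, birthDeathRate, h1, ← PNat.coe_inj, PNat.add_coe, PNat.one_coe]
  have := i.pos
  have := j.pos
  split_ifs <;> first | omega | ring

/-! ### Indicators as test functions and the total variation norm -/

/-- The indicator function of a set of states. -/
noncomputable def stateIndicator (A : Set ℕ+) : ℕ+ →ᵇ ℝ :=
  BoundedContinuousFunction.indicator A (isClopen_discrete A)

theorem stateIndicator_apply (A : Set ℕ+) (i : ℕ+) :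
    stateIndicator A i = A.indicator (fun _ => (1 : ℝ)) i := rfl

theorem integral_stateIndicator (μ : Measure ℕ+) (A : Set ℕ+) :
    ∫ i, stateIndicator A i ∂μ = μ.real A := by
  simp only [stateIndicator_apply]
  exact integral_indicator_one (MeasurableSet.of_discrete)

theorem birthDeathGenerator_stateIndicator (x : ℝ) (i j : ℕ+) :
    birthDeathGenerator x (stateIndicator {j}) i = exampleRate x i j := by
  simp [birthDeathGenerator_apply, exampleRate_eq, stateIndicator_apply, Set.indicator_apply]

theorem measure_ext_of_integral {μ ν : Measure ℕ+} [IsFiniteMeasure μ] [IsFiniteMeasure ν]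
    (h : ∀ f : ℕ+ →ᵇ ℝ, ∫ i, f i ∂μ = ∫ i, f i ∂ν) : μ = ν := by
  ext A -
  rw [← measureReal_eq_measureReal_iff, ← integral_stateIndicator, ← integral_stateIndicator, h]

theorem tvNorm_le {μ ν : Measure ℕ+} {b : ℝ} (h : ∀ A : Set ℕ+, μ.real A - ν.real A ≤ b) :
    tvNorm μ ν ≤ 2 * b := by
  have : Nonempty {A : Set ℕ+ // MeasurableSet A} := ⟨⟨∅, MeasurableSet.empty⟩⟩
  exact mul_le_mul_of_nonneg_left (ciSup_le fun A => h A.1) (by norm_num)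

theorem le_tvNorm (μ ν : Measure ℕ+) [IsProbabilityMeasure μ] (A : Set ℕ+) :
    2 * (μ.real A - ν.real A) ≤ tvNorm μ ν := by
  refine mul_le_mul_of_nonneg_left (le_ciSup (f := fun A : {A : Set ℕ+ // MeasurableSet A} =>
    μ.real A - ν.real A) ⟨1, ?_⟩ ⟨A, MeasurableSet.of_discrete⟩) (by norm_num)
  rintro _ ⟨B, rfl⟩
  have h1 : μ.real B.1 ≤ 1 := measureReal_le_one
  have h2 : 0 ≤ ν.real B.1 := measureReal_nonneg
  simp only
  linarith

/-! ### The geometric law -/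

/-- The geometric law `i ↦ (1 - x) x ^ (i - 1)` on `{1, 2, …}`. -/
noncomputable def geometricLaw (x : ℝ) : Measure ℕ+ :=
  Measure.sum fun n : ℕ => ENNReal.ofReal ((1 - x) * x ^ n) • Measure.dirac n.succPNat

theorem hasSum_geometricWeights {x : ℝ} (hx : x ∈ Ioo (0 : ℝ) 1) :
    HasSum (fun n : ℕ => (1 - x) * x ^ n) 1 := by
  have h := (hasSum_geometric_of_lt_one hx.1.le hx.2).mul_left (1 - x)
  rwa [mul_inv_cancel₀ (by linarith [hx.2])] at h

theorem geometricWeights_nonneg {x : ℝ} (hx : x ∈ Ioo (0 : ℝ) 1) (n : ℕ) :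
    0 ≤ (1 - x) * x ^ n :=
  mul_nonneg (by linarith [hx.2]) (pow_nonneg hx.1.le n)

theorem isProbabilityMeasure_geometricLaw {x : ℝ} (hx : x ∈ Ioo (0 : ℝ) 1) :
    IsProbabilityMeasure (geometricLaw x) :=
  (hasSum_geometricWeights hx).isProbabilityMeasure_sum_dirac (geometricWeights_nonneg hx)

theorem integrable_geometricLaw_iff {x : ℝ} (hx : x ∈ Ioo (0 : ℝ) 1) {f : ℕ+ → ℝ} :
    Integrable f (geometricLaw x) ↔
      Summable fun n : ℕ => (1 - x) * x ^ n * ‖f n.succPNat‖ := by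
  rw [geometricLaw, integrable_sum_dirac_iff (by simp)]
  congrm Summable (fun n => ?_ * _)
  rw [ENNReal.toReal_ofReal (geometricWeights_nonneg hx n)]

theorem hasSum_integral_geometricLaw {x : ℝ} (hx : x ∈ Ioo (0 : ℝ) 1) {f : ℕ+ → ℝ}
    (hf : Integrable f (geometricLaw x)) :
    HasSum (fun n : ℕ => (1 - x) * x ^ n * f n.succPNat) (∫ i, f i ∂geometricLaw x) := by
  have h := hf
  rw [geometricLaw] at h
  have h2 := hasSum_integral_measure h
  simp only [integral_smul_measure, ENNReal.toReal_ofReal (geometricWeights_nonneg hx _),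
    integral_dirac, smul_eq_mul] at h2
  exact h2

theorem geometricLaw_real {x : ℝ} (hx : x ∈ Ioo (0 : ℝ) 1) (A : Set ℕ+) :
    HasSum (fun n : ℕ => (1 - x) * x ^ n * A.indicator (fun _ => 1) n.succPNat)
      ((geometricLaw x).real A) := by
  have := isProbabilityMeasure_geometricLaw hx
  rw [← integral_stateIndicator]
  exact hasSum_integral_geometricLaw hx ((stateIndicator A).integrable _)

theorem geometricLaw_real_singleton {x : ℝ} (hx : x ∈ Ioo (0 : ℝ) 1) (i : ℕ+) :
    (geometricLaw x).real {i} = (1 - x) * x ^ ((i : ℕ) - 1) := by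
  refine (geometricLaw_real hx {i}).unique ?_
  have hi : ((i : ℕ) - 1).succPNat = i := by
    rw [← PNat.coe_inj, Nat.succPNat_coe]; have := i.pos; omega
  have h := hasSum_single (f := fun n : ℕ => (1 - x) * x ^ n *
    ({i} : Set ℕ+).indicator (fun _ => (1 : ℝ)) n.succPNat) ((i : ℕ) - 1) fun n hn => by
      have : n.succPNat ∉ ({i} : Set ℕ+) := by
        rw [mem_singleton_iff, ← PNat.coe_inj, Nat.succPNat_coe]; omega
      rw [indicator_of_notMem this, mul_zero]
  rwa [hi, indicator_of_mem (mem_singleton i), mul_one] at h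

theorem geometricLaw_singleton {x : ℝ} (hx : x ∈ Ioo (0 : ℝ) 1) (i : ℕ+) :
    geometricLaw x {i} = ENNReal.ofReal ((1 - x) * x ^ ((i : ℕ) - 1)) := by
  have := isProbabilityMeasure_geometricLaw hx
  rw [← geometricLaw_real_singleton hx, ofReal_measureReal]

theorem geometricLaw_real_tail {x : ℝ} (hx : x ∈ Ioo (0 : ℝ) 1) (m : ℕ) :
    (geometricLaw x).real {i | m < (i : ℕ)} = x ^ m := by
  have h := geometricLaw_real hx {i | m < (i : ℕ)}
  refine h.unique ((hasSum_nat_add_iff' m).1 ?_)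
  rw [Finset.sum_eq_zero, sub_zero]
  · convert! (hasSum_geometricWeights hx).mul_left (x ^ m) using 1
    · ext n
      rw [indicator_of_mem (by simp)]
      ring
    · simp
  · intro n hn
    rw [indicator_of_notMem (by simpa using hn), mul_zero]

/-- Integration against a finite measure as a continuous functional on bounded functions. -/
noncomputable def integralFunctional (μ : Measure ℕ+) [IsFiniteMeasure μ] : (ℕ+ →ᵇ ℝ) →L[ℝ] ℝ :=
  LinearMap.mkContinuous
    { toFun := fun f => ∫ i, f i ∂μ
      map_add' := fun f g => integral_add (f.integrable μ) (g.integrable μ)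
      map_smul' := fun a f => integral_const_mul a f }
    (μ.real univ) fun f => f.norm_integral_le_mul_norm μ

/-- Reindexing the birth sum loses the term `(1 - x) f 1`; the death sum, which counts state 1 once
more through truncation, gains the same term. -/
theorem integral_shiftedGenerator_geometricLaw {x : ℝ} (hx : x ∈ Ioo (0 : ℝ) 1) (f : ℕ+ →ᵇ ℝ) :
    ∫ i, shiftedGenerator x f i ∂geometricLaw x = (1 + x) * ∫ i, f i ∂geometricLaw x := by
  have := isProbabilityMeasure_geometricLaw hx
  have h := hasSum_integral_geometricLaw hx (f.integrable _)
  have hup := (hasSum_nat_add_iff' 1).2 h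
  have hdown : HasSum (fun n : ℕ => (1 - x) * x ^ n * f (n.succPNat - 1))
      (x * (∫ i, f i ∂geometricLaw x) + (1 - x) * f 1) := by
    refine (hasSum_nat_add_iff' 1).1 ?_
    convert! h.mul_left x using 1
    · ext n
      have : (n + 1).succPNat - 1 = n.succPNat := by
        rw [← PNat.coe_inj, PNat.sub_coe, if_pos]
        · simp
        · rw [← PNat.coe_lt_coe]; simp
      rw [this]; ring
    · have : Nat.succPNat 0 - 1 = 1 := rfl
      simp [this]
  refine (hasSum_integral_geometricLaw hx ((shiftedGenerator x f).integrable _)).unique ?_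
  convert! hup.add hdown using 1
  · ext n
    have : n.succPNat + 1 = (n + 1).succPNat := rfl
    rw [shiftedGenerator_apply, this]; ring
  · simp
    have : Nat.succPNat 0 = 1 := rfl
    rw [this]; ring

theorem integral_birthDeathSemigroup_geometricLaw {x : ℝ} (hx : x ∈ Ioo (0 : ℝ) 1) (t : ℝ)
    (f : ℕ+ →ᵇ ℝ) :
    ∫ i, birthDeathSemigroup x t f i ∂geometricLaw x = ∫ i, f i ∂geometricLaw x := by
  have := isProbabilityMeasure_geometricLaw hx
  exact apply_expSemigroup_eq (φ := integralFunctional (geometricLaw x)) t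
    (integral_shiftedGenerator_geometricLaw hx) f

/-! ### No Hölder continuity -/

/-- Take `x` and `y` to be the `(n+1)`-th roots of `1/2` and `1/4`: both tend to 1, so their
distance vanishes, yet the tails beyond `n + 1` have masses exactly `1/2` and `1/4`. -/
theorem exists_lt_tvNorm_geometricLaw {β : ℝ} (hβ : 0 < β) {ε : ℝ} (hε : 0 < ε) :
    ∃ x ∈ Ioo (0 : ℝ) 1, ∃ y ∈ Ioo (0 : ℝ) 1, x ≠ y ∧ |x - y| ^ β < ε ∧
      1 / 2 ≤ tvNorm (geometricLaw x) (geometricLaw y) := by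
  have hlim : ∀ a : ℝ, 0 < a → Tendsto (fun n : ℕ => a ^ (1 / ((n : ℝ) + 1))) atTop (𝓝 1) := by
    intro a ha
    have h := (Real.continuousAt_const_rpow ha.ne').tendsto.comp
      (tendsto_one_div_add_atTop_nhds_zero_nat (𝕜 := ℝ))
    rwa [Real.rpow_zero] at h
  have h := ((hlim (1 / 2) (by norm_num)).sub (hlim (1 / 4) (by norm_num))).abs
  have h2 := h.rpow_const (p := β) (Or.inr hβ.le)
  simp only [sub_self, abs_zero, Real.zero_rpow hβ.ne'] at h2
  obtain ⟨n, hn⟩ := (h2.eventually_lt_const hε).exists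
  have hn0 : (0 : ℝ) < 1 / ((n : ℝ) + 1) := by positivity
  have hmem : ∀ a : ℝ, 0 < a → a < 1 → a ^ (1 / ((n : ℝ) + 1)) ∈ Ioo (0 : ℝ) 1 := fun a h0 h1 =>
    ⟨Real.rpow_pos_of_pos h0 _, Real.rpow_lt_one h0.le h1 hn0⟩
  have hpow : ∀ a : ℝ, 0 < a → (a ^ (1 / ((n : ℝ) + 1))) ^ (n + 1) = a := fun a h0 => by
    rw [← Real.rpow_natCast, ← Real.rpow_mul h0.le]
    push_cast
    rw [one_div_mul_cancel (by positivity), Real.rpow_one]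
  have hx := hmem (1 / 2) (by norm_num) (by norm_num)
  have hy := hmem (1 / 4) (by norm_num) (by norm_num)
  refine ⟨_, hx, _, hy, (Real.rpow_lt_rpow (by norm_num) (by norm_num) hn0).ne', hn, ?_⟩
  have := isProbabilityMeasure_geometricLaw hx
  have h3 := le_tvNorm (geometricLaw ((1 / 2 : ℝ) ^ (1 / ((n : ℝ) + 1))))
    (geometricLaw ((1 / 4 : ℝ) ^ (1 / ((n : ℝ) + 1)))) {i | n + 1 < (i : ℕ)}
  rw [geometricLaw_real_tail hx, geometricLaw_real_tail hy, hpow _ (by norm_num),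
    hpow _ (by norm_num)] at h3
  linarith

theorem iSup_tvNorm_geometricLaw_div_eq_top {β : ℝ} (hβ : 0 < β) :
    (⨆ (x ∈ Ioo (0 : ℝ) 1) (y ∈ Ioo (0 : ℝ) 1) (_ : x ≠ y),
      ENNReal.ofReal (tvNorm (geometricLaw x) (geometricLaw y) / |x - y| ^ β)) = ⊤ := by
  refine ENNReal.eq_top_of_forall_nnreal_le fun r => ?_
  obtain ⟨x, hx, y, hy, hxy, hlt, htv⟩ :=
    -- Chosen so that `(r + 1) ε = 1/2`; the `+ 1` keeps `ε` finite and positive at `r = 0`.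
    exists_lt_tvNorm_geometricLaw hβ (ε := 1 / (2 * (r + 1))) (by positivity)
  refine le_iSup₂_of_le x hx (le_iSup₂_of_le y hy (le_iSup_of_le hxy ?_))
  rw [← ENNReal.ofReal_coe_nnreal]
  refine ENNReal.ofReal_le_ofReal ?_
  have hpos : 0 < |x - y| ^ β := Real.rpow_pos_of_pos (abs_pos.2 (sub_ne_zero.2 hxy)) _
  rw [le_div_iff₀ hpos]
  refine le_trans ?_ htv
  have hr : (0 : ℝ) ≤ r := r.2
  calc (r : ℝ) * |x - y| ^ β ≤ (r + 1) * (1 / (2 * (r + 1))) := by gcongr; linarith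
    _ = 1 / 2 := by field_simp

theorem not_exists_tvNorm_geometricLaw_le {β : ℝ} (hβ : 0 < β) :
    ¬ ∃ C : ℝ, ∀ x ∈ Ioo (0 : ℝ) 1, ∀ y ∈ Ioo (0 : ℝ) 1,
      tvNorm (geometricLaw x) (geometricLaw y) ≤ C * |x - y| ^ β := by
  rintro ⟨C, hC⟩
  obtain ⟨x, hx, y, hy, -, hlt, htv⟩ :=
    exists_lt_tvNorm_geometricLaw hβ (ε := 1 / (4 * (|C| + 1))) (by positivity)
  have h0 : 0 ≤ |x - y| ^ β := Real.rpow_nonneg (abs_nonneg _) _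
  have h1 : C * |x - y| ^ β ≤ (|C| + 1) * (1 / (4 * (|C| + 1))) := by
    gcongr
    linarith [le_abs_self C]
  have h2 : (|C| + 1) * (1 / (4 * (|C| + 1))) = 1 / 4 := by field_simp
  linarith [hC x hx y hy]

/-! ### Transition semigroups with the given rates -/

theorem IsTransitionSemigroup.integral_add {Q : ℕ+ → ℕ+ → ℝ} {P : ℝ≥0 → Kernel ℕ+ ℕ+}
    (hP : IsTransitionSemigroup Q P) (s t : ℝ≥0) (i : ℕ+) (f : ℕ+ →ᵇ ℝ) :
    ∫ j, f j ∂(P (s + t) i) = ∫ j, ∫ k, f k ∂(P t j) ∂(P s i) := by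
  have := hP.markov s
  have := hP.markov t
  rw [hP.add, Kernel.integral_comp (f.integrable _)]

theorem abs_integral_le_norm (μ : Measure ℕ+) [IsProbabilityMeasure μ] (f : ℕ+ →ᵇ ℝ) :
    |∫ j, f j ∂μ| ≤ ‖f‖ :=
  f.norm_integral_le_norm μ

theorem integrable_integral_kernel (κ : Kernel ℕ+ ℕ+) [IsMarkovKernel κ] (μ : Measure ℕ+)
    [IsFiniteMeasure μ] (f : ℕ+ →ᵇ ℝ) : Integrable (fun j => ∫ k, f k ∂κ j) μ :=
  Integrable.of_bound (Measurable.of_discrete.aestronglyMeasurable) ‖f‖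
    (Eventually.of_forall fun j => f.norm_integral_le_norm (κ j))

/-- Chapman-Kolmogorov, keeping only the intermediate state `i`. -/
theorem IsTransitionSemigroup.mul_le_diag {Q : ℕ+ → ℕ+ → ℝ} {P : ℝ≥0 → Kernel ℕ+ ℕ+}
    (hP : IsTransitionSemigroup Q P) (s t : ℝ≥0) (i : ℕ+) :
    (P s i).real {i} * (P t i).real {i} ≤ (P (s + t) i).real {i} := by
  have := hP.markov s
  have := hP.markov t
  rw [← integral_stateIndicator (P (s + t) i), hP.integral_add, ← integral_stateIndicator (P s i),
    ← integral_mul_const]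
  refine integral_mono (((stateIndicator {i}).integrable _).mul_const _)
    (integrable_integral_kernel _ _ _) fun j => ?_
  beta_reduce
  rw [integral_stateIndicator, stateIndicator_apply]
  by_cases h : j = i
  · simp [h]
  · simp [h, measureReal_nonneg]

theorem IsTransitionSemigroup.pow_le_diag {Q : ℕ+ → ℕ+ → ℝ} {P : ℝ≥0 → Kernel ℕ+ ℕ+}
    (hP : IsTransitionSemigroup Q P) (s : ℝ≥0) (i : ℕ+) (n : ℕ) :
    (P s i).real {i} ^ n ≤ (P (n * s) i).real {i} := by
  induction n with
  | zero => simp [hP.zero, Kernel.id_apply, measureReal_def]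
  | succ n ih =>
    rw [pow_succ]
    have h : ((n + 1 : ℕ) : ℝ≥0) * s = n * s + s := by push_cast; ring
    rw [h]
    exact (mul_le_mul_of_nonneg_right ih measureReal_nonneg).trans (hP.mul_le_diag _ _ i)

/-- Supermultiplicativity and Bernoulli give `p(t) ≥ p(t/n)^n ≥ 1 + n (p(t/n) - 1)`, whose right
side tends to `1 + t Q i i`. The derivative at zero thus yields a bound for all times. -/
theorem IsTransitionSemigroup.one_add_mul_rate_le_diag {Q : ℕ+ → ℕ+ → ℝ}
    {P : ℝ≥0 → Kernel ℕ+ ℕ+} (hP : IsTransitionSemigroup Q P) (t : ℝ≥0) (i : ℕ+) :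
    1 + t * Q i i ≤ (P t i).real {i} := by
  rcases eq_or_ne t 0 with rfl | ht
  · simp [hP.zero, Kernel.id_apply, measureReal_def]
  have hlim : Tendsto (fun n : ℕ => t / ((n : ℝ≥0) + 1)) atTop (𝓝[>] 0) := by
    refine tendsto_nhdsWithin_iff.2 ⟨?_, Eventually.of_forall fun n => ?_⟩
    · rw [← NNReal.tendsto_coe]
      have h := (tendsto_one_div_add_atTop_nhds_zero_nat (𝕜 := ℝ)).const_mul (t : ℝ)
      simpa [div_eq_mul_inv] using h
    · exact div_pos (pos_iff_ne_zero.2 ht) (by positivity)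
  have h := (((hP.rate i i).comp hlim).const_mul (t : ℝ)).const_add 1
  refine le_of_tendsto h (Eventually.of_forall fun n => ?_)
  have h2 := hP.pow_le_diag (t / ((n : ℝ≥0) + 1)) i (n + 1)
  have h3 : ((n + 1 : ℕ) : ℝ≥0) * (t / ((n : ℝ≥0) + 1)) = t := by
    push_cast; field_simp
  rw [h3] at h2
  have h4 : (0 : ℝ) ≤ (P (t / ((n : ℝ≥0) + 1)) i).real {i} := measureReal_nonneg
  have h5 := one_add_mul_le_pow (a := (P (t / ((n : ℝ≥0) + 1)) i).real {i} - 1) (by linarith)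
    (n + 1)
  rw [add_sub_cancel] at h5
  refine le_trans (le_of_eq ?_) (h5.trans h2)
  have ht' : (t : ℝ) ≠ 0 := by exact_mod_cast ht
  simp only [Function.comp, if_true]
  push_cast
  field_simp

variable {x : ℝ} {P : ℝ≥0 → Kernel ℕ+ ℕ+}

/-- The bound is uniform in `i` because the rates are bounded; this uniformity later supplies
continuity and domination. -/
theorem one_sub_le_diag (hP : IsTransitionSemigroup (exampleRate x) P)
    (t : ℝ≥0) (i : ℕ+) : 1 - (P t i).real {i} ≤ (1 + x) * t := by
  have h := hP.one_add_mul_rate_le_diag t i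
  have h2 : -(1 + x) ≤ exampleRate x i i := by
    have h3 : i + 1 ≠ i := by rw [← PNat.coe_inj.ne]; simp
    rw [exampleRate_eq, if_neg h3, if_pos rfl]
    split_ifs <;> linarith
  nlinarith [mul_le_mul_of_nonneg_left h2 t.2]

theorem abs_integral_sub_le (hP : IsTransitionSemigroup (exampleRate x) P)
    (t : ℝ≥0) (i : ℕ+) (f : ℕ+ →ᵇ ℝ) :
    |∫ j, f j ∂(P t i) - f i| ≤ 2 * (1 + x) * t * ‖f‖ := by
  have := hP.markov t
  have h1 : ∫ j, f j ∂(P t i) - f i = ∫ j, (f j - f i) ∂(P t i) := by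
    rw [integral_sub (f.integrable _) (integrable_const _)]; simp
  have h2 : ‖∫ j, (f j - f i) ∂(P t i)‖ ≤ ∫ j, 2 * ‖f‖ * stateIndicator {i}ᶜ j ∂(P t i) := by
    refine norm_integral_le_of_norm_le (((stateIndicator {i}ᶜ).integrable _).const_mul _)
      (Eventually.of_forall fun j => ?_)
    by_cases h : j = i
    · simp [h, stateIndicator_apply]
    · have := norm_sub_le (f j) (f i)
      have h1 := f.norm_coe_le_norm i
      have h2 := f.norm_coe_le_norm j
      simp only [stateIndicator_apply, indicator_of_mem (show j ∈ ({i}ᶜ : Set ℕ+) from h)]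
      linarith
  rw [integral_const_mul, integral_stateIndicator,
    probReal_compl_eq_one_sub (MeasurableSet.of_discrete)] at h2
  rw [h1]
  refine h2.trans ?_
  have := one_sub_le_diag hP t i
  nlinarith [norm_nonneg f]

/-- Entrywise derivatives extend to bounded test functions since row `i` of the rate matrix is
supported on `N` and sums to zero, so the mass outside `N` is `o(t)`. -/
theorem tendsto_integral_sub_div (hP : IsTransitionSemigroup (exampleRate x) P)
    (i : ℕ+) (f : ℕ+ →ᵇ ℝ) :
    Tendsto (fun t : ℝ≥0 => (∫ j, f j ∂(P t i) - f i) / t) (𝓝[>] 0)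
      (𝓝 (birthDeathGenerator x f i)) := by
  set N : Finset ℕ+ := {i, i + 1, i - 1} with hN
  have hi : i ∈ N := by simp [hN]
  have hrate : ∀ g : ℕ+ → ℝ, ∑ j ∈ N, exampleRate x i j * g j =
      x * g (i + 1) + g (i - 1) - (1 + x) * g i := by
    intro g
    simp only [exampleRate_eq, sub_mul, add_mul, Finset.sum_sub_distrib, Finset.sum_add_distrib,
      mul_ite, ite_mul, mul_one, mul_zero, zero_mul, Finset.sum_ite_eq, one_mul]
    simp [hN]
  have hsum : ∀ g : ℕ+ → ℝ, Tendsto (fun t : ℝ≥0 =>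
      ∑ j ∈ N, (((P t i).real {j} - (if i = j then 1 else 0)) / (t : ℝ)) * g j) (𝓝[>] 0)
      (𝓝 (x * g (i + 1) + g (i - 1) - (1 + x) * g i)) := by
    intro g
    rw [← hrate]
    exact tendsto_finsetSum _ fun j _ => (hP.rate i j).mul_const _
  have hsplit : ∀ (t : ℝ≥0) (g : ℕ+ → ℝ),
      ∑ j ∈ N, (((P t i).real {j} - (if i = j then 1 else 0)) / (t : ℝ)) * g j =
      (∑ j ∈ N, (P t i).real {j} * g j - g i) / t := by
    intro t g
    simp only [div_mul_eq_mul_div, ← Finset.sum_div, sub_mul, Finset.sum_sub_distrib, ite_mul,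
      one_mul, zero_mul, Finset.sum_ite_eq, hi, if_true]
  refine tendsto_of_tendsto_of_dist (hsum f) ?_
  -- Taking `g = 1` measures the mass escaping from `N`, relative to `t`.
  have hone := ((hsum fun _ => 1).neg).mul_const ‖f‖
  have h0 : -(x * 1 + 1 - (1 + x) * 1) * ‖f‖ = 0 := by ring
  rw [h0] at hone
  refine squeeze_zero (fun _ => dist_nonneg) (fun t => ?_) hone
  have := hP.markov t
  rw [hsplit, hsplit, Real.dist_eq, ← sub_div, sub_sub_sub_cancel_right, abs_div,
    NNReal.abs_eq, ← neg_div, div_mul_eq_mul_div]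
  refine div_le_div_of_nonneg_right ?_ t.2
  have hint : ∀ g : ℕ+ →ᵇ ℝ, ∑ j ∈ N, (P t i).real {j} * g j =
      ∫ j, stateIndicator (N : Set ℕ+) j * g j ∂(P t i) := by
    intro g
    have h1 : ∀ j, stateIndicator (N : Set ℕ+) j * g j = ∑ k ∈ N, stateIndicator {k} j * g k := by
      intro j
      simp only [stateIndicator_apply, indicator_apply, mem_singleton_iff, Finset.mem_coe,
        ite_mul, one_mul, zero_mul, Finset.sum_ite_eq]
    simp only [h1]
    rw [integral_finsetSum _ fun k _ => ((stateIndicator {k}).integrable _).mul_const _]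
    simp only [integral_mul_const, integral_stateIndicator]
  have h1 := hint 1
  simp only [BoundedContinuousFunction.coe_one, Pi.one_apply] at h1
  rw [hint f, h1]
  simp only [mul_one]
  have hNf : Integrable (fun j => stateIndicator (N : Set ℕ+) j * f j) (P t i) :=
    (stateIndicator (N : Set ℕ+) * f).integrable _
  rw [integral_stateIndicator, ← integral_sub hNf (f.integrable (P t i)), neg_sub,
    ← probReal_compl_eq_one_sub (MeasurableSet.of_discrete), ← integral_stateIndicator,
    ← integral_mul_const, ← Real.norm_eq_abs]
  refine norm_integral_le_of_norm_le
    (((stateIndicator (N : Set ℕ+)ᶜ).integrable (P t i)).mul_const _)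
    (Eventually.of_forall fun j => ?_)
  by_cases h : j ∈ (N : Set ℕ+)
  · simp [stateIndicator_apply, h]
  · simpa [stateIndicator_apply, h] using f.norm_coe_le_norm j

theorem abs_integral_sub_le_of_norm (hP : IsTransitionSemigroup (exampleRate x) P)
    (t : ℝ≥0) (i : ℕ+) (f g : ℕ+ →ᵇ ℝ) :
    |∫ j, f j ∂(P t i) - g i| ≤ ‖f - g‖ + 2 * (1 + x) * t * ‖g‖ := by
  have := hP.markov t
  have h1 := abs_integral_le_norm (P t i) (f - g)
  have h2 : ∫ j, (f - g) j ∂(P t i) = ∫ j, f j ∂(P t i) - ∫ j, g j ∂(P t i) :=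
    integral_sub (f.integrable _) (g.integrable _)
  rw [h2] at h1
  have h3 := abs_integral_sub_le hP t i g
  calc |∫ j, f j ∂(P t i) - g i|
      = |(∫ j, f j ∂(P t i) - ∫ j, g j ∂(P t i)) + (∫ j, g j ∂(P t i) - g i)| := by ring_nf
    _ ≤ _ := (abs_add_le _ _).trans (add_le_add h1 h3)

theorem integral_add_sub (hP : IsTransitionSemigroup (exampleRate x) P)
    (s h : ℝ≥0) (i : ℕ+) (f g : ℕ+ →ᵇ ℝ) :
    ∫ j, f j ∂(P (s + h) i) - ∫ j, g j ∂(P s i) = ∫ j, (∫ k, f k ∂(P h j) - g j) ∂(P s i) := by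
  have := hP.markov s
  have := hP.markov h
  rw [hP.integral_add, integral_sub (integrable_integral_kernel _ _ _) (g.integrable _)]

theorem abs_integral_add_sub_le (hP : IsTransitionSemigroup (exampleRate x) P)
    (s h : ℝ≥0) (i : ℕ+) (f g : ℕ+ →ᵇ ℝ) :
    |∫ j, f j ∂(P (s + h) i) - ∫ j, g j ∂(P s i)| ≤ ‖f - g‖ + 2 * (1 + x) * h * ‖g‖ := by
  have := hP.markov s
  rw [integral_add_sub hP]
  have h1 := norm_integral_le_of_norm_le_const (μ := P s i)
    (f := fun j => ∫ k, f k ∂(P h j) - g j) (Eventually.of_forall fun j => abs_integral_sub_le_of_norm hP h j f g)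
  simpa using h1

/-- If `g` is differentiable with derivative `-Q g`, the increments of `∫ g_s dP_s(i, ·)` are
of smaller order. -/
theorem tendsto_integral_add_sub_div (hP : IsTransitionSemigroup (exampleRate x) P)
    (s : ℝ≥0) (i : ℕ+) {g : ℝ≥0 → ℕ+ →ᵇ ℝ} {g₀ : ℕ+ →ᵇ ℝ}
    (hg : Tendsto (fun h : ℝ≥0 => (h : ℝ)⁻¹ • (g h - g₀)) (𝓝[>] 0)
      (𝓝 (-birthDeathGenerator x g₀))) :
    Tendsto (fun h : ℝ≥0 => (∫ j, g h j ∂(P (s + h) i) - ∫ j, g₀ j ∂(P s i)) / h) (𝓝[>] 0)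
      (𝓝 0) := by
  have := hP.markov s
  set A := birthDeathGenerator x g₀ with hA
  have hpos : ∀ᶠ h : ℝ≥0 in 𝓝[>] 0, 0 < h := eventually_mem_nhdsWithin
  have hcoe : Tendsto (fun h : ℝ≥0 => (h : ℝ)) (𝓝[>] 0) (𝓝 0) :=
    (NNReal.continuous_coe.tendsto' 0 0 rfl).mono_left nhdsWithin_le_nhds
  have hbound : ∀ᶠ h : ℝ≥0 in 𝓝[>] 0, ‖(h : ℝ)⁻¹ • (g h - g₀)‖ < ‖A‖ + 1 := by
    refine hg.norm.eventually_lt_const ?_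
    rw [norm_neg]; linarith
  -- Split the quotient as `P_h ((g_h - g₀)/h) + (P_h g₀ - g₀)/h`; the limits are `-Q g₀` and `Q
  -- g₀`.
  have hpt : ∀ j, Tendsto (fun h : ℝ≥0 => (∫ k, g h k ∂(P h j) - g₀ j) / h) (𝓝[>] 0) (𝓝 0) := by
    intro j
    have h1 : Tendsto (fun h : ℝ≥0 => ∫ k, ((h : ℝ)⁻¹ • (g h - g₀)) k ∂(P h j)) (𝓝[>] 0)
        (𝓝 (-A j)) := by
      rw [tendsto_iff_dist_tendsto_zero]
      have h2 := (tendsto_iff_norm_sub_tendsto_zero.1 hg).add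
        ((hcoe.const_mul (2 * (1 + x))).mul_const ‖-A‖)
      simp only [mul_zero, zero_mul, add_zero] at h2
      exact squeeze_zero (fun _ => dist_nonneg)
        (fun h => abs_integral_sub_le_of_norm hP h j _ (-A)) h2
    have h3 := h1.add (tendsto_integral_sub_div hP j g₀)
    rw [neg_add_cancel] at h3
    refine h3.congr fun h => ?_
    have := hP.markov h
    have h4 : ∫ k, ((h : ℝ)⁻¹ • (g h - g₀)) k ∂(P h j) =
        (h : ℝ)⁻¹ * (∫ k, g h k ∂(P h j) - ∫ k, g₀ k ∂(P h j)) := by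
      rw [← integral_sub ((g h).integrable _) (g₀.integrable _), ← integral_const_mul]
      rfl
    rw [h4]; ring
  have hdom := tendsto_integral_filter_of_dominated_convergence (μ := P s i)
    (F := fun (h : ℝ≥0) j => (∫ k, g h k ∂(P h j) - g₀ j) / (h : ℝ)) (f := fun _ => (0 : ℝ))
    (l := 𝓝[>] 0) (fun _ => ‖A‖ + 1 + 2 * (1 + x) * ‖g₀‖)
    (Eventually.of_forall fun h => Measurable.of_discrete.aestronglyMeasurable) ?_
    (integrable_const _) (Eventually.of_forall hpt)
  · rw [integral_zero] at hdom
    refine hdom.congr fun h => ?_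
    rw [integral_add_sub hP, integral_div]
  · filter_upwards [hbound, hpos] with h hb hh
    refine Eventually.of_forall fun j => ?_
    have hh' : (0 : ℝ) < h := hh
    rw [norm_smul, norm_inv, Real.norm_of_nonneg hh'.le, inv_mul_lt_iff₀ hh'] at hb
    rw [norm_div, Real.norm_of_nonneg hh'.le, div_le_iff₀ hh', Real.norm_eq_abs]
    refine (abs_integral_sub_le_of_norm hP h j _ _).trans ?_
    nlinarith

/-- The transition semigroup is determined by the rates. -/
theorem integral_eq_birthDeathSemigroup (hP : IsTransitionSemigroup (exampleRate x) P)
    (t : ℝ≥0) (i : ℕ+) (f : ℕ+ →ᵇ ℝ) :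
    ∫ j, f j ∂(P t i) = birthDeathSemigroup x t f i := by
  -- Interpolation: `v s = P_s exp((t-s)Q) f (i)` joins `exp(tQ) f (i)` at `s = 0` to `P_t f (i)` at
  -- `s = t`.
  set g : ℝ → ℕ+ →ᵇ ℝ := fun s => birthDeathSemigroup x (t - s) f with hg
  have hgd : ∀ s, HasDerivAt g (-birthDeathGenerator x (g s)) s := by
    intro s
    have h := (hasDerivAt_birthDeathSemigroup x (t - s) f).scomp s ((hasDerivAt_id s).const_sub _)
    simp only [neg_smul, one_smul] at h
    exact h
  have hgc : Continuous g := continuous_iff_continuousAt.2 fun s => (hgd s).continuousAt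
  set v : ℝ → ℝ := fun s => ∫ j, g s j ∂(P s.toNNReal i) with hv
  have hle : ∀ s r : ℝ, 0 ≤ s → s ≤ r →
      |v r - v s| ≤ ‖g r - g s‖ + 2 * (1 + x) * (r - s) * ‖g s‖ := by
    intro s r hs hr
    have h := abs_integral_add_sub_le hP s.toNNReal (r - s).toNNReal i (g r) (g s)
    rwa [← Real.toNNReal_add hs (by linarith), add_sub_cancel,
      Real.coe_toNNReal _ (by linarith : 0 ≤ r - s)] at h
  have hcont : ContinuousOn v (Icc 0 t) := by
    intro s hs
    -- `hle` only compares forward in time, so the majorant contains both norms to serve either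
    -- order of `r` and `s`.
    have hlim : Tendsto (fun r => ‖g r - g s‖ + |2 * (1 + x)| * |r - s| * (‖g r‖ + ‖g s‖))
        (𝓝[Icc 0 (t : ℝ)] s) (𝓝 0) := by
      have : Continuous fun r => ‖g r - g s‖ + |2 * (1 + x)| * |r - s| * (‖g r‖ + ‖g s‖) := by
        fun_prop
      exact (this.tendsto' s 0 (by simp)).mono_left nhdsWithin_le_nhds
    rw [ContinuousWithinAt, tendsto_iff_dist_tendsto_zero]
    refine squeeze_zero' (Eventually.of_forall fun _ => dist_nonneg) ?_ hlim
    filter_upwards [self_mem_nhdsWithin] with r hr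
    rw [Real.dist_eq]
    have hc := le_abs_self (2 * (1 + x))
    have hK := abs_nonneg (2 * (1 + x))
    rcases le_total s r with h | h
    · refine (hle s r hs.1 h).trans ?_
      rw [abs_of_nonneg (sub_nonneg.2 h)]
      gcongr
      · exact le_add_of_nonneg_left (norm_nonneg _)
    · rw [abs_sub_comm, norm_sub_rev, abs_sub_comm r s]
      refine (hle r s hr.1 h).trans ?_
      rw [abs_of_nonneg (sub_nonneg.2 h)]
      gcongr
      · exact le_add_of_nonneg_right (norm_nonneg _)
  -- A vanishing right derivative, together with continuity, suffices for constancy.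
  have hderiv : ∀ s ∈ Ico (0 : ℝ) t, HasDerivWithinAt v 0 (Ici s) s := by
    intro s hs
    rw [← hasDerivWithinAt_Ioi_iff_Ici, hasDerivWithinAt_iff_tendsto_slope' (by simp)]
    have hmap : Tendsto (fun r : ℝ => (r - s).toNNReal) (𝓝[>] s) (𝓝[>] 0) := by
      refine tendsto_nhdsWithin_iff.2 ⟨?_, ?_⟩
      · have : Continuous fun r : ℝ => (r - s).toNNReal := by fun_prop
        exact (this.tendsto' s 0 (by simp)).mono_left nhdsWithin_le_nhds
      · filter_upwards [self_mem_nhdsWithin] with r hr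
        simpa using hr
    have hadd : Tendsto (fun h : ℝ≥0 => s + h) (𝓝[>] 0) (𝓝[>] s) := by
      refine tendsto_nhdsWithin_iff.2 ⟨?_, ?_⟩
      · have : Continuous fun h : ℝ≥0 => s + h := by fun_prop
        exact (this.tendsto' 0 s (by simp)).mono_left nhdsWithin_le_nhds
      · filter_upwards [self_mem_nhdsWithin] with r hr
        simpa using hr
    have hslope := ((hasDerivWithinAt_iff_tendsto_slope' (by simp)).1
      (hgd s).hasDerivWithinAt).comp hadd
    have hmain := (tendsto_integral_add_sub_div hP s.toNNReal i (g := fun h => g (s + h))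
      (g₀ := g s) (hslope.congr fun h => by simp [slope_def_module])).comp hmap
    refine hmain.congr' ?_
    filter_upwards [self_mem_nhdsWithin] with r hr
    have hr' : 0 ≤ r - s := sub_nonneg.2 (le_of_lt hr)
    simp only [Function.comp, slope_def_field, hv]
    rw [← Real.toNNReal_add hs.1 hr', Real.coe_toNNReal _ hr', add_sub_cancel]
  have h := constant_of_has_deriv_right_zero hcont hderiv t ⟨t.2, le_rfl⟩
  simpa [hv, hg, hP.zero, birthDeathSemigroup, expSemigroup_zero, Kernel.id_apply] using h

/-! ### Existence of the transition semigroup -/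

/-- The `n`-th power of the kernel `i ↦ x δ_{i + 1} + δ_{i - 1}` (with `1 - 1 = 1`). -/
noncomputable def walkMeasure (x : ℝ) : ℕ → ℕ+ → Measure ℕ+
  | 0, i => Measure.dirac i
  | n + 1, i => ENNReal.ofReal x • walkMeasure x n (i + 1) + walkMeasure x n (i - 1)

theorem walkMeasure_univ {x : ℝ} (hx : 0 ≤ x) (n : ℕ) (i : ℕ+) :
    walkMeasure x n i univ = ENNReal.ofReal ((1 + x) ^ n) := by
  induction n generalizing i with
  | zero => simp [walkMeasure]
  | succ n ih =>
    rw [walkMeasure, Measure.add_apply, Measure.smul_apply, ih, ih, smul_eq_mul,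
      ← ENNReal.ofReal_mul hx, ← ENNReal.ofReal_add (by positivity) (by positivity)]
    ring_nf

theorem isFiniteMeasure_walkMeasure {x : ℝ} (hx : 0 ≤ x) (n : ℕ) (i : ℕ+) :
    IsFiniteMeasure (walkMeasure x n i) :=
  ⟨by rw [walkMeasure_univ hx]; exact ENNReal.ofReal_lt_top⟩

theorem integral_walkMeasure {x : ℝ} (hx : 0 ≤ x) (n : ℕ) (i : ℕ+) (f : ℕ+ →ᵇ ℝ) :
    ∫ j, f j ∂walkMeasure x n i = (shiftedGenerator x)^[n] f i := by
  induction n generalizing i with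
  | zero => simp [walkMeasure]
  | succ n ih =>
    have := isFiniteMeasure_walkMeasure hx n
    rw [walkMeasure, integral_add_measure ((f.integrable _).smul_measure ENNReal.ofReal_ne_top)
      (f.integrable _), integral_smul_measure, ih, ih, Function.iterate_succ_apply',
      shiftedGenerator_apply, ENNReal.toReal_ofReal hx, smul_eq_mul]

/-- The transition kernels of the birth-death chain, by uniformization. -/
noncomputable def birthDeathKernel (x : ℝ) (t : ℝ≥0) : Kernel ℕ+ ℕ+ :=
  Kernel.ofFunOfCountable fun i => Measure.sum fun n : ℕ =>
    ENNReal.ofReal (Real.exp (-(1 + x) * t) * ((t : ℝ) ^ n / n.factorial)) • walkMeasure x n i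

theorem birthDeathKernel_apply (x : ℝ) (t : ℝ≥0) (i : ℕ+) :
    birthDeathKernel x t i = Measure.sum fun n : ℕ =>
      ENNReal.ofReal (Real.exp (-(1 + x) * t) * ((t : ℝ) ^ n / n.factorial)) •
        walkMeasure x n i := rfl

theorem isMarkovKernel_birthDeathKernel {x : ℝ} (hx : 0 ≤ x) (t : ℝ≥0) :
    IsMarkovKernel (birthDeathKernel x t) := by
  refine ⟨fun i => ⟨?_⟩⟩
  -- The `n`-step mass `(1 + x) ^ n` is exactly compensated by the factor `exp(-(1 + x) t)`.
  have h := hasSum_exp_mul_pow_div_factorial (1 + x) t (1 + x) 1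
  simp only [mul_one, sub_self, zero_mul, Real.exp_zero] at h
  have hnn : ∀ n : ℕ, 0 ≤ Real.exp (-(1 + x) * t) * ((t : ℝ) ^ n / n.factorial) := fun n => by
    positivity
  rw [birthDeathKernel_apply, Measure.sum_apply _ MeasurableSet.univ]
  simp only [Measure.smul_apply, walkMeasure_univ hx, smul_eq_mul, ← ENNReal.ofReal_mul (hnn _)]
  rw [← ENNReal.ofReal_tsum_of_nonneg _ h.summable, h.tsum_eq, ENNReal.ofReal_one]
  intro n
  positivity

theorem integral_birthDeathKernel {x : ℝ} (hx : 0 ≤ x) (t : ℝ≥0) (i : ℕ+) (f : ℕ+ →ᵇ ℝ) :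
    ∫ j, f j ∂birthDeathKernel x t i = birthDeathSemigroup x t f i := by
  have := isMarkovKernel_birthDeathKernel hx t
  have h1 := f.integrable (birthDeathKernel x t i)
  rw [birthDeathKernel_apply] at h1
  have h2 := hasSum_integral_measure h1
  have hnn : ∀ n : ℕ, 0 ≤ Real.exp (-(1 + x) * t) * ((t : ℝ) ^ n / n.factorial) := fun n => by
    positivity
  simp only [integral_smul_measure, integral_walkMeasure hx, ENNReal.toReal_ofReal (hnn _),
    smul_eq_mul] at h2
  exact h2.unique (hasSum_expSemigroup (1 + x) (shiftedGenerator x) t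
    (BoundedContinuousFunction.evalCLM ℝ i) f)

theorem isTransitionSemigroup_birthDeathKernel {x : ℝ} (hx : 0 ≤ x) :
    IsTransitionSemigroup (exampleRate x) (birthDeathKernel x) where
  markov := isMarkovKernel_birthDeathKernel hx
  zero := by
    have := isMarkovKernel_birthDeathKernel hx
    ext1 i
    refine measure_ext_of_integral fun f => ?_
    rw [integral_birthDeathKernel hx, birthDeathSemigroup, NNReal.coe_zero, expSemigroup_zero,
      Kernel.id_apply, integral_dirac]
  add s t := by
    have := isMarkovKernel_birthDeathKernel hx
    ext1 i
    refine measure_ext_of_integral fun f => ?_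
    rw [Kernel.integral_comp (f.integrable _)]
    simp only [integral_birthDeathKernel hx]
    rw [NNReal.coe_add, birthDeathSemigroup, expSemigroup_add]
    rfl
  rate i j := by
    have h := (hasDerivAt_birthDeathSemigroup x 0 (stateIndicator {j}))
    have h0 : birthDeathSemigroup x 0 (stateIndicator {j}) = stateIndicator {j} :=
      expSemigroup_zero _ _ _
    have h2 := (hasDerivAt_iff_tendsto_slope.1 h).mono_left
      (nhdsWithin_mono 0 fun t (ht : t ∈ Ioi (0 : ℝ)) => ne_of_gt ht)
    have h3 := ((BoundedContinuousFunction.evalCLM ℝ i).continuous.tendsto _).comp h2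
    have hcoe : Tendsto (fun t : ℝ≥0 => (t : ℝ)) (𝓝[>] 0) (𝓝[>] 0) := by
      refine tendsto_nhdsWithin_iff.2 ⟨?_, ?_⟩
      · exact (NNReal.continuous_coe.tendsto' 0 0 rfl).mono_left nhdsWithin_le_nhds
      · filter_upwards [self_mem_nhdsWithin] with r hr
        simpa using hr
    have h4 := h3.comp hcoe
    rw [h0, BoundedContinuousFunction.evalCLM_apply, birthDeathGenerator_stateIndicator] at h4
    refine h4.congr fun t => ?_
    rw [← integral_stateIndicator, integral_birthDeathKernel hx]
    simp [slope_def_module, h0, stateIndicator_apply, indicator_apply, div_eq_inv_mul]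

theorem existsUnique_isTransitionSemigroup {x : ℝ} (hx : 0 ≤ x) :
    ∃! P : ℝ≥0 → Kernel ℕ+ ℕ+, IsTransitionSemigroup (exampleRate x) P := by
  refine ⟨birthDeathKernel x, isTransitionSemigroup_birthDeathKernel hx, fun P hP => ?_⟩
  have := hP.markov
  have := isMarkovKernel_birthDeathKernel hx
  ext1 t
  ext1 i
  refine measure_ext_of_integral fun f => ?_
  rw [integral_eq_birthDeathSemigroup hP, integral_birthDeathKernel hx]

theorem exists_lipschitzOnWith_exampleRate (i j : ℕ+) :
    ∃ K : ℝ≥0, LipschitzOnWith K (fun x : ℝ => exampleRate x i j) (Ioo 0 1) := by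
  refine ⟨1, LipschitzOnWith.of_dist_le_mul fun x _ y _ => ?_⟩
  have h : exampleRate x i j - exampleRate y i j =
      (x - y) * ((if i + 1 = j then 1 else 0) - (if i = j then 1 else 0)) := by
    rw [exampleRate_eq, exampleRate_eq]; ring
  rw [Real.dist_eq, Real.dist_eq, h, abs_mul, mul_comm, NNReal.coe_one]
  gcongr
  split_ifs <;> norm_num

/-! ### Exponential convergence -/

/-- Increments `d i = g(i+1) - g i` evolve by `d ↦ r² d(i+1) + d(i-1)` with `d 0 = 0`. The weight `ρ
^ i` has factor `r² ρ + ρ⁻¹`, minimal at `ρ = r⁻¹` with value `2r`; this is the source of the rate.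
-/
theorem abs_iterate_shiftedGenerator_sub_le {r : ℝ} (hr : r ∈ Ioo (0 : ℝ) 1) (A : Set ℕ+) (n : ℕ)
    (i : ℕ+) :
    |(shiftedGenerator (r ^ 2))^[n] (stateIndicator A) (i + 1) -
      (shiftedGenerator (r ^ 2))^[n] (stateIndicator A) i| ≤ (2 * r) ^ n * r⁻¹ ^ (i : ℕ) := by
  have hr0 := hr.1
  induction n generalizing i with
  | zero =>
    have h1 : (1 : ℝ) ≤ r⁻¹ ^ (i : ℕ) := one_le_pow₀ ((one_le_inv₀ hr.1).2 hr.2.le)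
    rw [Function.iterate_zero, id, stateIndicator_apply, stateIndicator_apply, pow_zero, one_mul]
    refine le_trans ?_ h1
    by_cases h2 : i + 1 ∈ A <;> by_cases h3 : i ∈ A <;> simp [h2, h3]
  | succ n ih =>
    rw [Function.iterate_succ_apply', shiftedGenerator_apply, shiftedGenerator_apply]
    set g := (shiftedGenerator (r ^ 2))^[n] (stateIndicator A) with hg
    have h1 := ih (i + 1)
    have h2 : |g i - g (i - 1)| ≤ (2 * r) ^ n * (r⁻¹ ^ (i : ℕ) * r) := by
      -- At the boundary the truncated difference is zero, so no bound is needed there.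
      rcases eq_or_ne i 1 with rfl | hi
      · have : (1 : ℕ+) - 1 = 1 := rfl
        rw [this, sub_self, abs_zero]
        positivity
      · have h3 : i - 1 + 1 = i := PNat.sub_add_of_lt (lt_of_le_of_ne one_le hi.symm)
        have h4 := ih (i - 1)
        rw [h3] at h4
        refine h4.trans (le_of_eq ?_)
        nth_rewrite 2 [← h3]
        rw [PNat.add_coe, PNat.one_coe, pow_succ]
        field_simp
    rw [PNat.add_sub]
    have h5 : r ^ 2 * g (i + 1 + 1) + g i - (r ^ 2 * g (i + 1) + g (i - 1)) =
      r ^ 2 * (g (i + 1 + 1) - g (i + 1)) + (g i - g (i - 1)) := by ring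
    rw [h5]
    refine (abs_add_le _ _).trans ?_
    rw [abs_mul, abs_of_nonneg (by positivity : 0 ≤ r ^ 2)]
    calc r ^ 2 * |g (i + 1 + 1) - g (i + 1)| + |g i - g (i - 1)|
        ≤ r ^ 2 * ((2 * r) ^ n * r⁻¹ ^ ((i + 1 : ℕ+) : ℕ)) +
          (2 * r) ^ n * (r⁻¹ ^ (i : ℕ) * r) := by gcongr
      _ = (2 * r) ^ (n + 1) * r⁻¹ ^ (i : ℕ) := by
        rw [PNat.add_coe, PNat.one_coe, pow_succ, pow_succ]
        linear_combination (2 * r) ^ n * r⁻¹ ^ (i : ℕ) * r * mul_inv_cancel₀ hr0.ne'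

theorem abs_birthDeathSemigroup_succ_sub_le {r : ℝ} (hr : r ∈ Ioo (0 : ℝ) 1) {t : ℝ} (ht : 0 ≤ t)
    (A : Set ℕ+) (i : ℕ+) :
    |birthDeathSemigroup (r ^ 2) t (stateIndicator A) (i + 1) -
      birthDeathSemigroup (r ^ 2) t (stateIndicator A) i| ≤
      Real.exp (-(1 - r) ^ 2 * t) * r⁻¹ ^ (i : ℕ) := by
  have h := abs_apply_expSemigroup_le (c := 1 + r ^ 2) (R := shiftedGenerator (r ^ 2)) ht
    (φ := BoundedContinuousFunction.evalCLM ℝ (i + 1) - BoundedContinuousFunction.evalCLM ℝ i)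
    (f := stateIndicator A) (fun n => abs_iterate_shiftedGenerator_sub_le hr A n i)
  have h1 : 2 * r - (1 + r ^ 2) = -(1 - r) ^ 2 := by ring
  rwa [h1] at h

/-- Telescoping to state 1; `K = r / (1 - r)` solves `K r⁻ⁱ + r⁻ⁱ = K r⁻⁽ⁱ⁺¹⁾`, so the induction
closes. -/
theorem abs_birthDeathSemigroup_sub_one_le {r : ℝ} (hr : r ∈ Ioo (0 : ℝ) 1) {t : ℝ} (ht : 0 ≤ t)
    (A : Set ℕ+) (i : ℕ+) :
    |birthDeathSemigroup (r ^ 2) t (stateIndicator A) i -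
      birthDeathSemigroup (r ^ 2) t (stateIndicator A) 1| ≤
      Real.exp (-(1 - r) ^ 2 * t) * (r / (1 - r) * r⁻¹ ^ (i : ℕ)) := by
  have hr0 := hr.1
  have hr1 : 0 < 1 - r := by linarith [hr.2]
  induction i using PNat.recOn with
  | one => rw [sub_self, abs_zero]; positivity
  | succ i ih =>
    refine (abs_sub_le _ (birthDeathSemigroup (r ^ 2) t (stateIndicator A) i) _).trans
      ((add_le_add (abs_birthDeathSemigroup_succ_sub_le hr ht A i) ih).trans (le_of_eq ?_))
    rw [PNat.add_coe, PNat.one_coe, inv_pow, inv_pow, pow_succ]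
    field_simp
    ring

/-- Weights of order `r ^ (2n)` beat growth of order `r⁻ⁿ`, leaving a geometric series in `r`. -/
theorem integrable_inv_pow_geometricLaw {r : ℝ} (hr : r ∈ Ioo (0 : ℝ) 1) :
    Integrable (fun i : ℕ+ => r⁻¹ ^ (i : ℕ)) (geometricLaw (r ^ 2)) := by
  have hr0 := hr.1
  have hx : r ^ 2 ∈ Ioo (0 : ℝ) 1 := ⟨by positivity, pow_lt_one₀ hr0.le hr.2 (by norm_num)⟩
  rw [integrable_geometricLaw_iff hx]
  refine ((summable_geometric_of_lt_one hr0.le hr.2).mul_left ((1 - r ^ 2) * r⁻¹)).congr fun n => ?_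
  rw [Nat.succPNat_coe, Real.norm_of_nonneg (by positivity), ← pow_mul, mul_comm 2 n, pow_mul,
    Nat.succ_eq_add_one, inv_pow, pow_succ]
  field_simp
  ring

theorem convergesAtRate_geometricLaw (hx : x ∈ Ioo (0 : ℝ) 1)
    (hP : IsTransitionSemigroup (exampleRate x) P) :
    ConvergesAtRate P (geometricLaw x) ((1 - Real.sqrt x) ^ 2) := by
  obtain ⟨r, hr, hrs, rfl⟩ : ∃ r ∈ Ioo (0 : ℝ) 1, Real.sqrt x = r ∧ r ^ 2 = x :=
    ⟨Real.sqrt x, ⟨Real.sqrt_pos.2 hx.1, by rw [Real.sqrt_lt' one_pos]; linarith [hx.2]⟩, rfl,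
      Real.sq_sqrt hx.1.le⟩
  have := isProbabilityMeasure_geometricLaw hx
  have hr0 := hr.1
  have hr1 : 0 < 1 - r := by linarith [hr.2]
  rw [hrs]
  set H := ∫ j : ℕ+, r⁻¹ ^ (j : ℕ) ∂geometricLaw (r ^ 2) with hH
  have hH0 : 0 ≤ H := integral_nonneg fun j => by positivity
  refine ⟨fun i => 2 * (r / (1 - r) * (r⁻¹ ^ (i : ℕ) + H)), fun i => by positivity,
    fun t i _ => ?_⟩
  rw [mul_assoc]
  refine tvNorm_le fun A => ?_
  have := hP.markov t
  set U := birthDeathSemigroup (r ^ 2) t (stateIndicator A) with hU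
  -- Invariance turns the limit mass of `A` into the average of `U`, so the gap is an average of `U
  -- i - U j`, compared through state 1.
  rw [← integral_stateIndicator, ← integral_stateIndicator, integral_eq_birthDeathSemigroup hP,
    ← integral_birthDeathSemigroup_geometricLaw hx t]
  have h1 : U i - ∫ j, U j ∂geometricLaw (r ^ 2) = ∫ j, (U i - U j) ∂geometricLaw (r ^ 2) := by
    rw [integral_sub (integrable_const _) (U.integrable _)]; simp
  have hint := integrable_inv_pow_geometricLaw hr
  have h2 : ∫ j, (U i - U j) ∂geometricLaw (r ^ 2) ≤
      ∫ j : ℕ+, Real.exp (-(1 - r) ^ 2 * t) * (r / (1 - r)) * (r⁻¹ ^ (i : ℕ) + r⁻¹ ^ (j : ℕ))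
        ∂geometricLaw (r ^ 2) := by
    refine integral_mono ((integrable_const _).sub (U.integrable _))
      (((integrable_const _).add hint).const_mul _) fun j => ?_
    have h3 := le_of_abs_le (abs_birthDeathSemigroup_sub_one_le hr t.2 A i)
    have h4 := neg_le_of_abs_le (abs_birthDeathSemigroup_sub_one_le hr t.2 A j)
    simp only [NNReal.val_eq_coe, ← hU] at h3 h4
    beta_reduce
    linarith
  rw [← hU, h1]
  refine h2.trans (le_of_eq ?_)
  rw [integral_const_mul, integral_add (integrable_const _) hint, ← hH]
  simp
  ring

theorem exponentiallyErgodic_geometricLaw (hx : x ∈ Ioo (0 : ℝ) 1)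
    (hP : IsTransitionSemigroup (exampleRate x) P) : ExponentiallyErgodic P (geometricLaw x) := by
  have h : Real.sqrt x < 1 := by rw [Real.sqrt_lt' one_pos]; linarith [hx.2]
  exact ⟨_, pow_pos (sub_pos.2 h) 2, convergesAtRate_geometricLaw hx hP⟩

/-! ### The invariant law -/

theorem integral_bind_kernel (μ : Measure ℕ+) [IsFiniteMeasure μ] (κ : Kernel ℕ+ ℕ+)
    [IsMarkovKernel κ] (f : ℕ+ →ᵇ ℝ) : ∫ j, f j ∂(μ.bind κ) = ∫ i, ∫ j, f j ∂κ i ∂μ := by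
  have h := Kernel.integral_comp (κ := Kernel.const Unit μ) (η := κ) (a := ()) (f.integrable _)
  rwa [Kernel.comp_apply, Kernel.const_apply] at h

theorem isInvariantLaw_geometricLaw (hx : x ∈ Ioo (0 : ℝ) 1)
    (hP : IsTransitionSemigroup (exampleRate x) P) : IsInvariantLaw P (geometricLaw x) := by
  have hpr := isProbabilityMeasure_geometricLaw hx
  refine ⟨hpr, fun t => ?_⟩
  have := hP.markov t
  refine measure_ext_of_integral fun f => ?_
  rw [integral_bind_kernel]
  simp only [integral_eq_birthDeathSemigroup hP]
  exact integral_birthDeathSemigroup_geometricLaw hx t f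

theorem tendsto_measureReal_atTop (hx : x ∈ Ioo (0 : ℝ) 1)
    (hP : IsTransitionSemigroup (exampleRate x) P) (A : Set ℕ+) (i : ℕ+) :
    Tendsto (fun t => (P t i).real A) atTop (𝓝 ((geometricLaw x).real A)) := by
  have hpr := isProbabilityMeasure_geometricLaw hx
  obtain ⟨ε, hε, C, -, hC⟩ := exponentiallyErgodic_geometricLaw hx hP
  have hlim : Tendsto (fun t : ℝ≥0 => C i * Real.exp (-ε * t) / 2) atTop (𝓝 0) := by
    have h1 : Tendsto (fun t : ℝ≥0 => -ε * (t : ℝ)) atTop atBot :=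
      (tendsto_const_mul_atBot_of_neg (by linarith)).2 (NNReal.tendsto_coe_atTop.2 tendsto_id)
    simpa using ((Real.tendsto_exp_atBot.comp h1).const_mul (C i)).div_const 2
  rw [tendsto_iff_dist_tendsto_zero]
  refine squeeze_zero' (Eventually.of_forall fun _ => dist_nonneg) ?_ hlim
  filter_upwards [eventually_gt_atTop 0] with t ht
  have := hP.markov t
  have h := hC t i ht
  have h1 := le_tvNorm (P t i) (geometricLaw x) A
  -- The complement supplies the other sign, since `tvNorm` is a one-sided supremum.
  have h2 := le_tvNorm (P t i) (geometricLaw x) Aᶜ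
  rw [probReal_compl_eq_one_sub MeasurableSet.of_discrete,
    probReal_compl_eq_one_sub MeasurableSet.of_discrete] at h2
  rw [Real.dist_eq, abs_le]
  constructor <;> linarith

/-- For invariant `μ`, `μ A` is the `μ`-average of `P_t(i, A)` for every `t`; dominated convergence
as `t → ∞` identifies it. -/
theorem isInvariantLaw_iff (hx : x ∈ Ioo (0 : ℝ) 1)
    (hP : IsTransitionSemigroup (exampleRate x) P) (μ : Measure ℕ+) :
    IsInvariantLaw P μ ↔ μ = geometricLaw x := by
  refine ⟨fun ⟨hpr, hinv⟩ => ?_, fun h => h ▸ isInvariantLaw_geometricLaw hx hP⟩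
  have := isProbabilityMeasure_geometricLaw hx
  ext A -
  rw [← measureReal_eq_measureReal_iff]
  have hlim := tendsto_integral_filter_of_dominated_convergence (μ := μ) (l := atTop)
    (F := fun (t : ℝ≥0) i => (P t i).real A) (f := fun _ => (geometricLaw x).real A) (fun _ => 1)
    (Eventually.of_forall fun t => Measurable.of_discrete.aestronglyMeasurable)
    (Eventually.of_forall fun t => Eventually.of_forall fun i => by
      have := hP.markov t
      rw [Real.norm_of_nonneg measureReal_nonneg]
      exact measureReal_le_one)
    (integrable_const _) (Eventually.of_forall fun i => tendsto_measureReal_atTop hx hP A i)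
  have hconst : ∀ t, ∫ i, (P t i).real A ∂μ = μ.real A := by
    intro t
    have := hP.markov t
    have h := integral_bind_kernel μ (P t) (stateIndicator A)
    rw [(hinv t).def] at h
    simpa only [integral_stateIndicator] using h.symm
  simp only [hconst, integral_const, probReal_univ, one_smul] at hlim
  exact tendsto_nhds_unique tendsto_const_nhds hlim

/-! ### Failure of strong ergodicity -/

/-- `R` enlarges the weight `2⁻ⁱ` by at most `x/2 + 2 < 3`. The growth factor is immaterial; only
decay in `i` at fixed `t` is used. -/
theorem abs_iterate_shiftedGenerator_le (hx : x ∈ Ioo (0 : ℝ) 1) (n : ℕ) (i : ℕ+) :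
    |(shiftedGenerator x)^[n] (stateIndicator {1}) i| ≤ 3 ^ n * (2 * (1 / 2) ^ (i : ℕ)) := by
  induction n generalizing i with
  | zero =>
    by_cases h : i = 1
    · simp [h, stateIndicator_apply]
    · simp [h, stateIndicator_apply]
  | succ n ih =>
    rw [Function.iterate_succ_apply', shiftedGenerator_apply]
    set g := (shiftedGenerator x)^[n] (stateIndicator {1}) with hg
    have h1 : |g (i + 1)| ≤ 3 ^ n * (1 / 2) ^ (i : ℕ) := by
      refine (ih (i + 1)).trans (le_of_eq ?_)
      rw [PNat.add_coe, PNat.one_coe, pow_succ]; ring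
    have h2 : |g (i - 1)| ≤ 3 ^ n * (4 * (1 / 2) ^ (i : ℕ)) := by
      refine (ih (i - 1)).trans ?_
      rcases eq_or_ne i 1 with rfl | hi
      · have : (1 : ℕ+) - 1 = 1 := rfl
        rw [this]
        gcongr
        norm_num
      · have h3 : i - 1 + 1 = i := PNat.sub_add_of_lt (lt_of_le_of_ne one_le hi.symm)
        nth_rewrite 2 [← h3]
        rw [PNat.add_coe, PNat.one_coe, pow_succ]
        apply le_of_eq
        ring
    refine (abs_add_le _ _).trans ?_
    rw [abs_mul, abs_of_pos hx.1, pow_succ]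
    have h3 : x * |g (i + 1)| ≤ 1 * |g (i + 1)| :=
      mul_le_mul_of_nonneg_right hx.2.le (abs_nonneg _)
    have h4 : (0 : ℝ) ≤ 3 ^ n * (1 / 2) ^ (i : ℕ) := by positivity
    linarith

theorem tendsto_measureReal_one_succPNat (hx : x ∈ Ioo (0 : ℝ) 1)
    (hP : IsTransitionSemigroup (exampleRate x) P) (t : ℝ≥0) :
    Tendsto (fun n : ℕ => (P t n.succPNat).real {1}) atTop (𝓝 0) := by
  have hlim : Tendsto (fun n : ℕ => Real.exp ((3 - (1 + x)) * t) * (2 * (1 / 2 : ℝ) ^ (n + 1)))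
      atTop (𝓝 0) := by
    have h := (tendsto_pow_atTop_nhds_zero_of_lt_one (r := (1 / 2 : ℝ)) (by norm_num)
      (by norm_num)).comp (tendsto_add_atTop_nat 1)
    simpa using (h.const_mul 2).const_mul (Real.exp ((3 - (1 + x)) * t))
  refine squeeze_zero (fun _ => measureReal_nonneg) (fun n => ?_) hlim
  rw [← integral_stateIndicator, integral_eq_birthDeathSemigroup hP]
  exact (le_abs_self _).trans (abs_apply_expSemigroup_le (c := 1 + x) t.2
    (φ := BoundedContinuousFunction.evalCLM ℝ n.succPNat)
    (fun m => abs_iterate_shiftedGenerator_le hx m n.succPNat))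

theorem not_stronglyErgodic_geometricLaw (hx : x ∈ Ioo (0 : ℝ) 1)
    (hP : IsTransitionSemigroup (exampleRate x) P) : ¬ StronglyErgodic P (geometricLaw x) := by
  intro h
  have hpr := isProbabilityMeasure_geometricLaw hx
  have hle : ∀ t, 2 * (1 - x) ≤ ⨆ i, tvNorm (P t i) (geometricLaw x) := by
    intro t
    have := hP.markov t
    -- Needed because an unbounded real supremum would default to zero.
    have hbdd : BddAbove (range fun i => tvNorm (P t i) (geometricLaw x)) := by
      refine ⟨2 * 1, ?_⟩
      rintro _ ⟨i, rfl⟩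
      refine tvNorm_le fun A => ?_
      have h1 : (P t i).real A ≤ 1 := measureReal_le_one
      have h2 : 0 ≤ (geometricLaw x).real A := measureReal_nonneg
      linarith
    have hlim := ((tendsto_measureReal_one_succPNat hx hP t).const_sub (1 - x)).const_mul 2
    rw [sub_zero] at hlim
    refine le_of_tendsto hlim (Eventually.of_forall fun n => ?_)
    refine le_trans ?_ (le_ciSup hbdd n.succPNat)
    -- Off state 1 the chain started far away has mass near 1, the limit law only `x`.
    have h1 := le_tvNorm (P t n.succPNat) (geometricLaw x) {1}ᶜ
    rw [probReal_compl_eq_one_sub MeasurableSet.of_discrete,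
      probReal_compl_eq_one_sub MeasurableSet.of_discrete, geometricLaw_real_singleton hx] at h1
    simp only [PNat.one_coe, tsub_self, pow_zero, mul_one] at h1
    linarith
  have h1 := ge_of_tendsto' h hle
  linarith [hx.2]

/-! ### Assembly of the result -/

theorem mainTheorem6 :
    -- the rates are Lipschitz in `x`
    (∀ i j : ℕ+, ∃ K : ℝ≥0, LipschitzOnWith K (fun x : ℝ => exampleRate x i j) (Ioo 0 1)) ∧
    -- the chain exists and its semigroup is determined by the rates
    (∀ x ∈ Ioo (0 : ℝ) 1, ∃! P : ℝ≥0 → Kernel ℕ+ ℕ+, IsTransitionSemigroup (exampleRate x) P) ∧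
    ∀ P : ℝ → ℝ≥0 → Kernel ℕ+ ℕ+,
      (∀ x ∈ Ioo (0 : ℝ) 1, IsTransitionSemigroup (exampleRate x) (P x)) →
      ∃ π : ℝ → Measure ℕ+,
        (∀ x ∈ Ioo (0 : ℝ) 1,
          -- `π x` is the unique invariant probability measure, and it is geometric
          (∀ μ : Measure ℕ+, IsInvariantLaw (P x) μ ↔ μ = π x) ∧
          (∀ i : ℕ+, π x {i} = ENNReal.ofReal ((1 - x) * x ^ ((i : ℕ) - 1))) ∧
          ExponentiallyErgodic (P x) (π x) ∧
          ConvergesAtRate (P x) (π x) ((1 - Real.sqrt x) ^ 2) ∧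
          ¬ StronglyErgodic (P x) (π x)) ∧
        -- no Hölder continuity
        ∀ β ∈ Ioc (0 : ℝ) 1,
          (⨆ (x ∈ Ioo (0 : ℝ) 1) (y ∈ Ioo (0 : ℝ) 1) (_ : x ≠ y),
            ENNReal.ofReal (tvNorm (π x) (π y) / |x - y| ^ β)) = ⊤ ∧
          ¬ ∃ C : ℝ, ∀ x ∈ Ioo (0 : ℝ) 1, ∀ y ∈ Ioo (0 : ℝ) 1,
            tvNorm (π x) (π y) ≤ C * |x - y| ^ β := by
  refine ⟨exists_lipschitzOnWith_exampleRate,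
    fun x hx => existsUnique_isTransitionSemigroup hx.1.le, fun P hP => ⟨geometricLaw, ?_, ?_⟩⟩
  · exact fun x hx => ⟨isInvariantLaw_iff hx (hP x hx), geometricLaw_singleton hx,
      exponentiallyErgodic_geometricLaw hx (hP x hx), convergesAtRate_geometricLaw hx (hP x hx),
      not_stronglyErgodic_geometricLaw hx (hP x hx)⟩
  · exact fun β hβ => ⟨iSup_tvNorm_geometricLaw_div_eq_top hβ.1,
      not_exists_tvNorm_geometricLaw_le hβ.1⟩
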